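/- Let $k$ be an algebraically closed field of characteristic $p \ge 0$, let $E$ be an elliptic curve over $k$ with function field $k(E)$, and let $G \subset E(k)$ be a finite subgroup whose order $n = |G|$ is not divisible by $p$. Let $\Delta = \sum_{g \in G} (g)$ and let $$\mathcal{L}(G) = \{ f \in k(E) \mid f = 0 \text{ or } \operatorname{div}(f) \ge -\Delta \}.$$ Let $G$ act on $k(E)$ by translations, $(g \cdot f)(u) = f(u+g)$. Then: 1. $\dim_k \mathcal{L}(G) = n$. 2. $\mathcal{L}(G)$ is stable under the action of $G$, and as a $G$-representation it is isomorphic to the regular representation of $G$, that is, to the space $\mathrm{Map}(G,k)$ of all functions $f : G \to k$ with $(g \cdot f)(h) = f(h+g)$. 3. For each character $\chi \in \mathrm{Hom}(G, k^*)$ there is a nonzero function $f_\chi \in \mathcal{L}(G)$ (a Jacobi function belonging to $\chi$) such that $f_\chi(u+g) = \chi(g) f_\chi(u)$ for all $g \in G$, as an identity of rational functions of $u$. It is unique up to a nonzero multiplicative constant: the nonzero functions in $\mathcal{L}(G)$ with this property are exactly the $c f_\chi$ with $c \in k^*$. -/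

import Mathlib

namespace JacobiFunctions

section

open Polynomial nonZeroDivisors WeierstrassCurve.Affine
open scoped Polynomial.Bivariate

variable {k : Type*} [Field k] (W : WeierstrassCurve.Affine k)

/-- The affine coordinate ring `k[W]` is a finitely generated `k`-algebra. -/
theorem coordinateRing_finiteType : Algebra.FiniteType k W.CoordinateRing := by
  have : Module.Finite k[X] W.CoordinateRing := .of_basis (CoordinateRing.basis W)
  exact Algebra.FiniteType.trans (S := k[X]) inferInstance inferInstance

/-- Every maximal ideal of `k[W]` is the ideal of an affine point. -/
theorem exists_eq_XYIdeal [IsAlgClosed k] (M : Ideal W.CoordinateRing) (hM : M.IsMaximal) :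
    ∃ x y : k, W.Equation x y ∧ M = CoordinateRing.XYIdeal W x (C y) := by
  let _ := Ideal.Quotient.field M
  have := coordinateRing_finiteType W
  have : Module.Finite k (W.CoordinateRing ⧸ M) := finite_of_finite_type_of_isJacobsonRing k _
  have hb := IsAlgClosed.algebraMap_bijective_of_isIntegral (k := k) (K := W.CoordinateRing ⧸ M)
  obtain ⟨x, hx⟩ := hb.2 (Ideal.Quotient.mk M (CoordinateRing.mk W (C X)))
  obtain ⟨y, hy⟩ := hb.2 (Ideal.Quotient.mk M (CoordinateRing.mk W Y))
  have key : ((algebraMap k (W.CoordinateRing ⧸ M)).comp (evalEvalRingHom x y)) =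
      (Ideal.Quotient.mk M).comp (CoordinateRing.mk W) := by
    apply Polynomial.ringHom_ext'
    · apply Polynomial.ringHom_ext'
      · ext a
        simp only [RingHom.comp_apply, coe_evalRingHom, eval_C]
        rfl
      · simp only [RingHom.comp_apply, coe_evalRingHom, eval_C, eval_X]
        exact hx
    · simp only [RingHom.comp_apply, coe_evalRingHom, eval_C, eval_X]
      exact hy
  have heq : W.Equation x y := by
    apply hb.1
    have := congrArg (fun f => f W.polynomial) key
    simp only [RingHom.comp_apply, AdjoinRoot.mk_self, map_zero] at this
    rw [map_zero]
    exact this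
  refine ⟨x, y, heq, ?_⟩
  have hmax : (CoordinateRing.XYIdeal W x (C y)).IsMaximal :=
    Ideal.Quotient.maximal_of_isField _
      ((CoordinateRing.quotientXYIdealEquiv (W' := W) (x := x) (y := C y)
        heq).toMulEquiv.isField (Field.toIsField k))
  refine (hmax.eq_of_le hM.ne_top ?_).symm
  rw [CoordinateRing.XYIdeal, Ideal.span_le]
  rintro _ (rfl | rfl)
  · refine Ideal.Quotient.eq_zero_iff_mem.mp ?_
    have := congrArg (fun f => f (C (X - C x))) key
    simp only [RingHom.comp_apply] at this
    rw [CoordinateRing.XClass, ← this]; simp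
  · refine Ideal.Quotient.eq_zero_iff_mem.mp ?_
    have := congrArg (fun f => f (Y - C (C y))) key
    simp only [RingHom.comp_apply] at this
    rw [CoordinateRing.YClass, ← this]; simp

theorem coordinateRing_isNoetherianRing : IsNoetherianRing W.CoordinateRing :=
  have := coordinateRing_finiteType W
  Algebra.FiniteType.isNoetherianRing k _

/-- Every nonzero ideal of `k[W]` is invertible, as the ideals of the points are. -/
theorem exists_mul_eq_one [IsAlgClosed k] [W.IsElliptic] (I : Ideal W.CoordinateRing) (hI : I ≠ ⊥) :
    ∃ J : FractionalIdeal W.CoordinateRing⁰ W.FunctionField, (I : FractionalIdeal _ _) * J = 1 := by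
  have := coordinateRing_isNoetherianRing W
  induction I using IsNoetherian.induction with
  | hgt I ih =>
  by_cases htop : I = ⊤
  · exact ⟨1, by simp [htop]⟩
  obtain ⟨M, hM, hIM⟩ := Ideal.exists_le_maximal I htop
  obtain ⟨x, y, h, hMe⟩ := exists_eq_XYIdeal W M hM
  let u := CoordinateRing.XYIdeal' (W := W) (equation_iff_nonsingular.mp h)
  have hu : (u : FractionalIdeal W.CoordinateRing⁰ W.FunctionField) = (M : FractionalIdeal _ _) := by
    rw [hMe]; rfl
  have hle : (↑u⁻¹ * (I : FractionalIdeal W.CoordinateRing⁰ W.FunctionField)) ≤ 1 := by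
    rw [← u.inv_mul, hu]
    gcongr
  obtain ⟨J, hJ⟩ := FractionalIdeal.le_one_iff_exists_coeIdeal.mp hle
  have hIJ : I = M * J := by
    apply FractionalIdeal.coeIdeal_injective (K := W.FunctionField)
    simp only
    rw [FractionalIdeal.coeIdeal_mul, hJ, ← hu, ← mul_assoc, u.mul_inv, one_mul]
  have hlt : I < J := by
    refine lt_of_le_of_ne (hIJ.le.trans Ideal.mul_le_right) fun hEq => ?_
    obtain ⟨r, hr, hr0⟩ := Submodule.exists_sub_one_mem_and_smul_eq_zero_of_fg_of_le_smul M I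
      (IsNoetherian.noetherian I) (by rw [smul_eq_mul]; nth_rw 1 [hIJ]; rw [← hEq])
    obtain ⟨a, ha, ha0⟩ := Submodule.exists_mem_ne_zero_of_ne_bot hI
    have : r = 0 := (mul_eq_zero.mp (hr0 a ha)).resolve_right ha0
    rw [this, zero_sub, neg_mem_iff] at hr
    exact hM.ne_top ((Ideal.eq_top_iff_one _).mpr hr)
  obtain ⟨J', hJ'⟩ := ih J hlt (fun h => hI (by rw [hIJ, h, Ideal.mul_bot]))
  refine ⟨↑u⁻¹ * J', ?_⟩
  rw [hIJ, FractionalIdeal.coeIdeal_mul, ← hu, mul_mul_mul_comm, u.mul_inv, hJ', one_mul]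

/-- The affine coordinate ring of an elliptic curve is a Dedekind domain. -/
instance coordinateRing_isDedekindDomain [IsAlgClosed k] [W.IsElliptic] :
    IsDedekindDomain W.CoordinateRing := by
  rw [isDedekindDomain_iff_mul_inv_cancel (K := W.FunctionField)]
  intro I hI
  obtain ⟨a, J, ha, rfl⟩ := FractionalIdeal.exists_eq_spanSingleton_mul I
  have ha' : algebraMap W.CoordinateRing W.FunctionField a ≠ 0 :=
    (map_ne_zero_iff _ (IsFractionRing.injective _ _)).mpr ha
  obtain ⟨J', hJ'⟩ := exists_mul_eq_one W J (by rintro rfl; simp at hI)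
  refine (FractionalIdeal.mul_inv_cancel_iff _).mpr
    ⟨FractionalIdeal.spanSingleton _ (algebraMap _ _ a) * J', ?_⟩
  rw [mul_mul_mul_comm, hJ', FractionalIdeal.spanSingleton_mul_spanSingleton,
    inv_mul_cancel₀ ha', FractionalIdeal.spanSingleton_one, one_mul]

theorem degree_norm_add_le (a b : W.CoordinateRing) :
    (Algebra.norm k[X] (a + b)).degree ≤
      max (Algebra.norm k[X] a).degree (Algebra.norm k[X] b).degree := by
  obtain ⟨p, q, rfl⟩ := CoordinateRing.exists_smul_basis_eq a
  obtain ⟨p', q', rfl⟩ := CoordinateRing.exists_smul_basis_eq b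
  rw [add_add_add_comm, ← add_smul, ← add_smul]
  simp only [CoordinateRing.degree_norm_smul_basis]
  have h2 : Monotone fun d : WithBot ℕ => 2 • d := fun _ _ h => nsmul_le_nsmul_right h 2
  have h3 : Monotone fun d : WithBot ℕ => 2 • d + 3 := fun _ _ h => by dsimp only; gcongr
  have hp := h2 (degree_add_le p p')
  have hq := h3 (degree_add_le q q')
  replace hp := hp.trans_eq h2.map_max
  replace hq := hq.trans_eq h3.map_max
  exact (max_le_max hp hq).trans_eq (max_max_max_comm ..)

theorem norm_ne_zero {a : W.CoordinateRing} (ha : a ≠ 0) : Algebra.norm k[X] a ≠ 0 :=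
  Algebra.norm_ne_zero_iff_of_basis (CoordinateRing.basis W) |>.mpr ha

open WithZero in
open scoped Classical in
/-- The multiplicative valuation at the point at infinity on `k[W]`. The pole order at infinity of a
nonzero `a` is the number of zeros of `a` in the affine part of the curve, which is the degree of
the norm `N(a) ∈ k[X]`; for `a = p + q Y` it is `max (2 deg p) (2 deg q + 3)`, so `X` has a double
and `Y` a triple pole. -/
noncomputable def inftyIntValuation : Valuation W.CoordinateRing (WithZero (Multiplicative ℤ)) where
  toFun a := if a = 0 then 0 else exp ((Algebra.norm k[X] a).natDegree : ℤ)
  map_zero' := by simp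
  map_one' := by simp
  map_mul' a b := by
    by_cases ha : a = 0
    · simp [ha]
    by_cases hb : b = 0
    · simp [hb]
    rw [if_neg ha, if_neg hb, if_neg (mul_ne_zero ha hb), map_mul,
      natDegree_mul (norm_ne_zero W ha) (norm_ne_zero W hb), Nat.cast_add, exp_add]
  map_add_le_max' a b := by
    by_cases ha : a = 0
    · simp [ha]
    by_cases hb : b = 0
    · simp [hb]
    by_cases hab : a + b = 0
    · simp [hab]
    have h := degree_norm_add_le W a b
    rw [degree_eq_natDegree (norm_ne_zero W ha), degree_eq_natDegree (norm_ne_zero W hb),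
      degree_eq_natDegree (norm_ne_zero W hab)] at h
    simp only [if_neg ha, if_neg hb, if_neg hab]
    rw [le_max_iff] at h ⊢
    simpa using h

/-- The multiplicative valuation at the point at infinity on the function field. -/
noncomputable def inftyValuation : Valuation W.FunctionField (WithZero (Multiplicative ℤ)) :=
  (inftyIntValuation W).extendToLocalization (S := W.CoordinateRing⁰) (fun a ha => by
    change inftyIntValuation W a ≠ 0
    simp [inftyIntValuation, nonZeroDivisors.ne_zero ha]) W.FunctionField

variable {W} in
/-- The Weierstrass polynomial evaluated at a pair of elements of an extension. -/
theorem eval₂_polynomial {L : Type*} [Field L] [Algebra k L] (x y : L) :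
    W.polynomial.eval₂ (aeval x : k[X] →ₐ[k] L) y = (W⁄L).polynomial.evalEval x y := by
  simp [WeierstrassCurve.Affine.polynomial, evalEval, eval₂_add, eval₂_mul, eval₂_pow, eval₂_C,
    ← C_pow, - map_pow]
  simp only [map_pow, aeval_X]

/-- The `k`-algebra homomorphism `k[W] → L` sending `X`, `Y` to the coordinates of an `L`-point. -/
noncomputable def evalHom {L : Type*} [Field L] [Algebra k L] {x y : L} (h : (W⁄L).Equation x y) :
    W.CoordinateRing →ₐ[k] L :=
  AdjoinRoot.liftAlgHom W.polynomial (aeval x) y ((eval₂_polynomial x y).trans h)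

theorem evalHom_X {L : Type*} [Field L] [Algebra k L] {x y : L} (h : (W⁄L).Equation x y) :
    evalHom W h (CoordinateRing.mk W (C X)) = x := by
  simp [evalHom]

theorem evalHom_Y {L : Type*} [Field L] [Algebra k L] {x y : L} (h : (W⁄L).Equation x y) :
    evalHom W h (CoordinateRing.mk W Y) = y := by
  simp [evalHom]

theorem algHom_mk {L : Type*} [Field L] [Algebra k L] (φ : W.CoordinateRing →ₐ[k] L) (p : k[X][Y]) :
    φ (CoordinateRing.mk W p) = p.eval₂ (aeval (φ (CoordinateRing.mk W (C X))) : k[X] →ₐ[k] L)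
      (φ (CoordinateRing.mk W Y)) := by
  have : (φ : W.CoordinateRing →+* L).comp (CoordinateRing.mk W) =
    eval₂RingHom ((aeval (φ (CoordinateRing.mk W (C X))) : k[X] →ₐ[k] L) : k[X] →+* L)
      (φ (CoordinateRing.mk W Y)) := by
    apply Polynomial.ringHom_ext'
    · apply Polynomial.ringHom_ext'
      · ext a
        simp only [RingHom.comp_apply, coe_eval₂RingHom, eval₂_C, RingHom.coe_coe, aeval_C]
        exact φ.commutes a
      · simp only [RingHom.comp_apply, coe_eval₂RingHom, eval₂_C, RingHom.coe_coe, aeval_X]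
    · simp only [RingHom.comp_apply, coe_eval₂RingHom, eval₂_X, RingHom.coe_coe]
  exact congrArg (fun f => f p) this

theorem equation_algHom {L : Type*} [Field L] [Algebra k L] (φ : W.CoordinateRing →ₐ[k] L) :
    (W⁄L).Equation (φ (CoordinateRing.mk W (C X))) (φ (CoordinateRing.mk W Y)) := by
  rw [Equation, ← eval₂_polynomial, ← algHom_mk, AdjoinRoot.mk_self, map_zero]

theorem mem_range_of_aeval_eq_zero [IsAlgClosed k] {L : Type*} [Field L] [Algebra k L] {t : L}
    {p : k[X]} (hp : p ≠ 0) (h : aeval t p = 0) : ∃ a, algebraMap k L a = t := by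
  have hint : IsIntegral k t := isAlgebraic_iff_isIntegral.mp ⟨p, hp, h⟩
  have : Algebra.IsAlgebraic k (IntermediateField.adjoin k {t}) :=
    IntermediateField.isAlgebraic_adjoin_simple hint
  have ht := IntermediateField.mem_adjoin_simple_self k t
  rw [IntermediateField.eq_bot_of_isAlgClosed_of_isAlgebraic (IntermediateField.adjoin k {t})] at ht
  exact IntermediateField.mem_bot.mp ht

/-- A non-injective `k`-algebra homomorphism from `k[W]` to a field is evaluation at a `k`-point. -/
theorem const_of_not_injective [IsAlgClosed k] {L : Type*} [Field L] [Algebra k L]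
    (φ : W.CoordinateRing →ₐ[k] L) (hφ : ¬ Function.Injective φ) :
    ∃ x y, W.Equation x y ∧ φ (CoordinateRing.mk W (C X)) = algebraMap k L x ∧
      φ (CoordinateRing.mk W Y) = algebraMap k L y := by
  obtain ⟨a, ha, ha0⟩ : ∃ a, φ a = 0 ∧ a ≠ 0 := by
    by_contra! hc
    exact hφ ((injective_iff_map_eq_zero φ).mpr hc)
  have hx : ∃ x, algebraMap k L x = φ (CoordinateRing.mk W (C X)) := by
    refine mem_range_of_aeval_eq_zero (norm_ne_zero W ha0) ?_
    obtain ⟨p, q, rfl⟩ := CoordinateRing.exists_smul_basis_eq a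
    have hn := congrArg φ (CoordinateRing.coe_norm_smul_basis (W' := W) p q)
    have hpq : CoordinateRing.mk W (C p + C q * Y) =
        p • (1 : W.CoordinateRing) + q • CoordinateRing.mk W Y := by
      simp only [CoordinateRing.smul, map_add, map_mul, mul_one]
    rw [map_mul, map_mul, hpq, ha, zero_mul] at hn
    rw [← hn]
    have := algHom_mk W φ (C (Algebra.norm k[X] (p • (1 : W.CoordinateRing) + q • CoordinateRing.mk W Y)))
    rw [eval₂_C] at this
    exact this.symm
  obtain ⟨x, hx⟩ := hx
  have heq := equation_algHom W φ
  have hy : ∃ y, algebraMap k L y = φ (CoordinateRing.mk W Y) := by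
    refine mem_range_of_aeval_eq_zero (p := W.polynomial.map (evalRingHom x))
      ((WeierstrassCurve.Affine.monic_polynomial (W := W)).map _).ne_zero ?_
    rw [aeval_def, eval₂_map]
    rw [Equation, ← eval₂_polynomial, ← hx] at heq
    convert heq using 2
    ext p <;> simp
  obtain ⟨y, hy⟩ := hy
  rw [← hx, ← hy] at heq ⊢
  exact ⟨x, y, (W.map_equation (algebraMap k L).injective x y).mp heq, rfl, rfl⟩

/-- The coordinate function `X` in the function field. -/
noncomputable def genericX : W.FunctionField :=
  algebraMap W.CoordinateRing W.FunctionField (CoordinateRing.mk W (C X))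
/-- The coordinate function `Y` in the function field. -/
noncomputable def genericY : W.FunctionField :=
  algebraMap W.CoordinateRing W.FunctionField (CoordinateRing.mk W Y)


theorem equation_generic : (W⁄W.FunctionField).Equation (genericX W) (genericY W) :=
  equation_algHom W (IsScalarTower.toAlgHom k W.CoordinateRing W.FunctionField)


theorem genericX_ne (c : k) : genericX W ≠ algebraMap k W.FunctionField c := by
  intro h
  apply CoordinateRing.XClass_ne_zero (W' := W) c
  apply IsFractionRing.injective W.CoordinateRing W.FunctionField
  rw [map_zero, CoordinateRing.XClass, map_sub, map_sub, map_sub, sub_eq_zero]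
  exact h

variable {W} in
/-- The coordinates of an affine point (with junk value `(0, 0)` at infinity). -/
noncomputable def coords : W.Point → k × k
  | .zero => 0
  | .some x y _ => (x, y)

variable {W} in
theorem nonsingular_coords {P : W.Point} (hP : P ≠ 0) : W.Nonsingular (coords P).1 (coords P).2 := by
  cases P with
  | zero => exact absurd rfl hP
  | some x y h => exact h

variable {W} in
theorem some_coords {P : W.Point} (hP : P ≠ 0) : .some _ _ (nonsingular_coords hP) = P := by
  cases P with
  | zero => exact absurd rfl hP
  | some x y h => rfl

section
variable [W.IsElliptic]

instance baseChange_isElliptic : (W⁄W.FunctionField).IsElliptic :=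
  inferInstanceAs (W.map (algebraMap k W.FunctionField)).IsElliptic

/-- The generic point `η = (X, Y)` of the curve, as a point with coordinates in `k(W)`. -/
noncomputable def genericPoint : (W⁄W.FunctionField).Point :=
  .some (genericX W) (genericY W) (equation_iff_nonsingular.mp (equation_generic W))

open scoped Classical in
theorem algHom_eq {φ ψ : W.FunctionField →ₐ[k] W.FunctionField}
    (h : Point.map (W' := W) φ (genericPoint W) = Point.map (W' := W) ψ (genericPoint W)) :
    φ = ψ := by
  obtain ⟨hx, hy⟩ := Point.some.inj h
  let ι := IsScalarTower.toAlgHom k W.CoordinateRing W.FunctionField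
  have : ∀ a, φ (algebraMap W.CoordinateRing _ a) = ψ (algebraMap W.CoordinateRing _ a) := by
    intro a
    obtain ⟨p, rfl⟩ := AdjoinRoot.mk_surjective a
    have e1 := algHom_mk W (φ.comp ι) p
    have e2 := algHom_mk W (ψ.comp ι) p
    have hx' : φ.comp ι (CoordinateRing.mk W (C X)) = ψ.comp ι (CoordinateRing.mk W (C X)) := hx
    have hy' : φ.comp ι (CoordinateRing.mk W Y) = ψ.comp ι (CoordinateRing.mk W Y) := hy
    rw [hx', hy'] at e1
    exact e1.trans e2.symm
  refine AlgHom.ext fun f => ?_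
  obtain ⟨a, b, hb, rfl⟩ := IsFractionRing.div_surjective (A := W.CoordinateRing) f
  rw [map_div₀, map_div₀, this, this]

variable [DecidableEq k]

open scoped Classical in
/-- A point of `W` over `k`, seen as a point with coordinates in `k(W)`. -/
noncomputable def constPoint : W.Point →+ (W⁄W.FunctionField).Point :=
  Point.baseChange (W' := W) k W.FunctionField

open scoped Classical in
theorem map_constPoint (φ : W.FunctionField →ₐ[k] W.FunctionField) (P : W.Point) :
    Point.map (W' := W) φ (constPoint W P) = constPoint W P :=
  Point.map_baseChange (W' := W) (F := k) φ P

theorem genericPoint_ne (P : W.Point) : genericPoint W ≠ constPoint W P := by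
  cases P with
  | zero => exact Point.some_ne_zero _
  | some x y h =>
    intro he
    exact genericX_ne W x (Point.some.inj he).1

open scoped Classical in
/-- The point `η + P`, where `η` is the generic point. Its coordinates are the rational functions
`u ↦ X (u + P)` and `u ↦ Y (u + P)`. -/
noncomputable def translatedPoint (P : W.Point) : (W⁄W.FunctionField).Point :=
  genericPoint W + constPoint W P

open scoped Classical in
theorem translatedPoint_ne (P Q : W.Point) : translatedPoint W P ≠ constPoint W Q := by
  intro h
  apply genericPoint_ne W (Q - P)
  rw [map_sub, ← h, translatedPoint, add_sub_cancel_right]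

theorem translatedPoint_ne_zero (P : W.Point) : translatedPoint W P ≠ 0 :=
  translatedPoint_ne W P 0

/-- Pullback of regular functions on the affine part along the translation `u ↦ u + P`: the
`k`-algebra homomorphism sending `X`, `Y` to the coordinates of `η + P`. -/
noncomputable def translateCoordinateRing (P : W.Point) : W.CoordinateRing →ₐ[k] W.FunctionField :=
  evalHom W (nonsingular_coords (translatedPoint_ne_zero W P)).1

theorem translateCoordinateRing_injective [IsAlgClosed k] (P : W.Point) :
    Function.Injective (translateCoordinateRing W P) := by
  by_contra hc
  obtain ⟨x, y, h, hx, hy⟩ := const_of_not_injective W _ hc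
  apply translatedPoint_ne W P (.some x y (equation_iff_nonsingular.mp h))
  rw [translateCoordinateRing, evalHom_X] at hx
  rw [translateCoordinateRing, evalHom_Y] at hy
  rw [← some_coords (translatedPoint_ne_zero W P)]
  exact (Point.some.injEq ..).mpr ⟨hx, hy⟩

variable [IsAlgClosed k]

/-- Pullback of rational functions along the translation by `P`: the automorphism of the function
field sending `f` to the function `u ↦ f (u + P)`. -/
noncomputable def translate (P : W.Point) : W.FunctionField →ₐ[k] W.FunctionField :=
  IsFractionRing.liftAlgHom (translateCoordinateRing_injective W P)

open scoped Classical in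
/-- Pullback along the translation by `P` moves the generic point `η` to `η + P`. -/
theorem map_translate (P : W.Point) : Point.map (W' := W) (translate W P) (genericPoint W) =
    genericPoint W + constPoint W P := by
  have h1 : translate W P (genericX W) = (coords (translatedPoint W P)).1 := by
    rw [translate, genericX, IsFractionRing.liftAlgHom_apply, IsFractionRing.lift_algebraMap]
    exact evalHom_X ..
  have h2 : translate W P (genericY W) = (coords (translatedPoint W P)).2 := by
    rw [translate, genericY, IsFractionRing.liftAlgHom_apply, IsFractionRing.lift_algebraMap]
    exact evalHom_Y ..
  refine Eq.trans ?_ (some_coords (translatedPoint_ne_zero W P))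
  exact (Point.some.injEq ..).mpr ⟨h1, h2⟩

open scoped Classical in
theorem translate_zero : translate W 0 = AlgHom.id k _ := by
  apply algHom_eq
  rw [map_translate, map_zero, add_zero]
  rfl

open scoped Classical in
theorem translate_add (P Q : W.Point) :
    translate W (P + Q) = (translate W P).comp (translate W Q) := by
  apply algHom_eq
  rw [← Point.map_map, map_translate, map_translate, map_add, map_add, map_translate,
    map_constPoint, add_assoc]

/-- The representation of the group of points on the function field, `(P • f) (u) = f (u + P)`. -/
noncomputable def translationRep : Representation k (Multiplicative W.Point) W.FunctionField where
  toFun P := (translate W P.toAdd).toLinearMap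
  map_one' := by
    rw [toAdd_one, translate_zero]; rfl
  map_mul' P Q := by
    rw [toAdd_mul, translate_add]; rfl

end

/-- The valuation at the point at infinity is trivial on constants. -/
theorem inftyValuation_algebraMap_le (c : k) :
    inftyValuation W (algebraMap k W.FunctionField c) ≤ 1 := by
  rw [IsScalarTower.algebraMap_apply k W.CoordinateRing W.FunctionField, inftyValuation,
    Valuation.extendToLocalization_apply_map_apply]
  change (if _ then _ else _) ≤ _
  split_ifs with h
  · exact zero_le
  · have : algebraMap k W.CoordinateRing c = C c • 1 + (0 : k[X]) • CoordinateRing.mk W Y := by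
      rw [zero_smul, add_zero, Algebra.smul_def, mul_one]; rfl
    rw [this, CoordinateRing.norm_smul_basis, zero_pow two_ne_zero, mul_zero, zero_mul, zero_mul,
      sub_zero, sub_zero, ← C_pow, natDegree_C]
    simp

/-- The maximal ideal of `k[W]` of functions vanishing at the affine point `(x, y)`. -/
noncomputable def pointIdeal [W.IsElliptic] {x y : k} (h : W.Nonsingular x y) :
    IsDedekindDomain.HeightOneSpectrum W.CoordinateRing where
  asIdeal := CoordinateRing.XYIdeal W x (C y)
  isPrime := (Ideal.Quotient.maximal_of_isField _
    ((CoordinateRing.quotientXYIdealEquiv (W' := W) (x := x) (y := C y)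
      h.1).toMulEquiv.isField (Field.toIsField k))).isPrime
  ne_bot hb := CoordinateRing.XClass_ne_zero (W' := W) x <| by
    rw [← Ideal.mem_bot, ← hb]
    exact Ideal.subset_span (Set.mem_insert _ _)

section

variable [IsAlgClosed k] [W.IsElliptic]

/-- The multiplicative valuation of the function field at a point `P` of the curve: for a nonzero
rational function `f`, it is `exp (- ord_P f)`, where `ord_P f` is the order of vanishing. -/
noncomputable def pointValuation : W.Point → Valuation W.FunctionField (WithZero (Multiplicative ℤ))
  | .zero => inftyValuation W
  | .some _ _ h => (pointIdeal W h).valuation W.FunctionField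

theorem pointValuation_algebraMap_le (P : W.Point) (c : k) :
    pointValuation W P (algebraMap k W.FunctionField c) ≤ 1 := by
  cases P with
  | zero => exact inftyValuation_algebraMap_le W c
  | some x y h =>
    rw [IsScalarTower.algebraMap_apply k W.CoordinateRing W.FunctionField]
    exact IsDedekindDomain.HeightOneSpectrum.valuation_le_one _ _

/-- The Riemann-Roch space of a divisor `D`: all rational functions `f` with `f = 0` or
`div f ≥ - D`, that is, with `ord_P f ≥ - D P` at every point `P`. -/
noncomputable def riemannRochSpace (D : W.Point →₀ ℤ) : Submodule k W.FunctionField where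
  carrier := {f | ∀ P, pointValuation W P f ≤ WithZero.exp (D P)}
  zero_mem' P := by simp
  add_mem' hf hg P := (Valuation.map_add _ _ _).trans (max_le (hf P) (hg P))
  smul_mem' c f hf P := by
    rw [Algebra.smul_def, map_mul]
    exact (mul_le_of_le_one_left' (pointValuation_algebraMap_le W P c)).trans (hf P)

variable [DecidableEq k]

/-- The divisor `Δ = ∑ (g)`, the sum over all points `g` of a finite subgroup. -/
noncomputable def subgroupDivisor (G : AddSubgroup W.Point) [Finite G] : W.Point →₀ ℤ :=
  ∑ᶠ g : G, Finsupp.single (g : W.Point) 1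

/-- The space `L(G)` of all rational functions `f` with `div f ≥ - Δ`. -/
noncomputable def subgroupSpace (G : AddSubgroup W.Point) [Finite G] :
    Submodule k W.FunctionField :=
  riemannRochSpace W (subgroupDivisor W G)

/-- The representation of a group `G` of points on the function field by translations,
`(g • f) (u) = f (u + g)`. -/
noncomputable def subgroupRep (G : AddSubgroup W.Point) :
    Representation k (Multiplicative G) W.FunctionField :=
  (translationRep W).comp (AddMonoidHom.toMultiplicative G.subtype)

/-- `f` is a (generalized) Jacobi function belonging to the character `χ` of `G`: a nonzero element
of `L(G)` with `f (u + g) = χ(g) f (u)` for all `g` in `G`, as an identity of rational functions. -/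
def IsJacobiFunction (G : AddSubgroup W.Point) [Finite G] (χ : Multiplicative G →* kˣ)
    (f : W.FunctionField) : Prop :=
  f ∈ subgroupSpace W G ∧ f ≠ 0 ∧
    ∀ g : G, translate W (g : W.Point) f = (χ (Multiplicative.ofAdd g) : k) • f

end

end

/-- The regular representation of `G`: all functions `f : G → k`, with `(g • f) (h) = f (h g)`. -/
def regularRep (k G : Type*) [Field k] [Group G] : Representation k G (G → k) where
  toFun g := LinearMap.funLeft k k (fun h => h * g)
  map_one' := by ext; simp
  map_mul' a b := LinearMap.ext fun f => funext fun h => by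
    simp [LinearMap.funLeft_apply, mul_assoc]

end JacobiFunctions

/-!
For a point `P = (x, y)` of the curve let `λ_P = (Y - y) / (X - x)` be the function `slopeFunction`
(and `λ_0 = 0`). The ideals of `P` and `-P` in `k[W]` have product `(X - x)`, so `λ_P` has simple
poles exactly at `0` and `-P` (`inftyValuation_slopeFunction`,
`pointValuation_slopeFunction_le_one`, `pointValuation_neg_slopeFunction`).

Hence `1` and the `λ_g`, for `g` in `G` nonzero, lie in `L(G)`, and they are linearly independent by
their poles. They span `L(G)`: the affine poles of an element of `L(G)` can be removed by subtracting
multiples of the `λ_g`, and a function with at most a simple pole, at infinity, is constant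
(`mem_of_pointValuation_le`). This gives the basis `slopeBasis` and the dimension, without the
Riemann-Roch theorem.

The translation by `A` acts on this basis by `λ_P ↦ λ_{P + A} - λ_A + c` with a constant `c`
(`translate_slopeFunction`). This is the cocycle identity `slope_addX_addY_eq` for slopes of chords,
applied to the generic point, `A` and `P`. In particular `L(G)` is stable under `G`.

A functional `φ` on `L(G)` defines an equivariant map `f ↦ (g ↦ φ (g • f))` to the functions on `G`.
Let `φ = r + l`, where `r` is the residue at `0` read off from the basis and `l` is the sum over `G`
of the translates of a functional that is `1` on constants. If `φ` vanishes on all translates of `f`,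
then summing over `G`, where the residues cancel, gives `|G| l(f) = 0`. As `|G|` is invertible in
`k`, all residues of `f` vanish as well, so that `f` is constant, and then zero. So the map is
injective, and bijective by dimension (`nonempty_equiv_regularRep`). In the regular representation,
the functions belonging to a character `χ` are the multiples of `χ`.
-/

namespace JacobiFunctions

/-! ### Slopes of chords -/

section

open Polynomial WeierstrassCurve.Affine

variable {F : Type*} [Field F] [DecidableEq F] {W : WeierstrassCurve.Affine F}

/-- The line of slope `ℓ` through `(x₁, y₁)` and `(x₂, y₂)` meets the curve in a third point with
coordinate `addX`, so the Weierstrass polynomial restricted to the line is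
`-(X - x₁) (X - x₂) (X - addX)`; the identity compares the derivatives at `x₁`. It also covers the
tangent line, where `x₁ = x₂`. -/
theorem sub_mul_addX_sub {x₁ x₂ y₁ y₂ : F} (h₁ : W.Equation x₁ y₁) (h₂ : W.Equation x₂ y₂)
    (hxy : ¬(x₁ = x₂ ∧ y₁ = W.negY x₂ y₂)) :
    (x₂ - x₁) * (W.addX x₁ x₂ (W.slope x₁ x₂ y₁ y₂) - x₁) =
      3 * x₁ ^ 2 + 2 * W.a₂ * x₁ + W.a₄ - W.a₁ * y₁ -
        (2 * y₁ + W.a₁ * x₁ + W.a₃) * W.slope x₁ x₂ y₁ y₂ := by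
  have h := congrArg (fun p => p.derivative.eval x₁) (addPolynomial_slope h₁ h₂ hxy)
  simp only [addPolynomial_eq, Cubic.toPoly] at h
  simp [derivative_pow] at h
  rw [addX]
  linear_combination h

theorem slope_mul {x₁ x₂ y₁ y₂ : F} (h₁ : W.Equation x₁ y₁) (h₂ : W.Equation x₂ y₂)
    (hxy : ¬(x₁ = x₂ ∧ y₁ = W.negY x₂ y₂)) :
    W.slope x₁ x₂ y₁ y₂ * (x₁ - x₂) = y₁ - y₂ := by
  by_cases hx : x₁ = x₂
  · have := Y_eq_of_Y_ne h₁ h₂ hx fun h => hxy ⟨hx, h⟩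
    rw [hx, this]; ring
  · rw [slope_of_X_ne hx, div_mul_cancel₀ _ (sub_ne_zero.mpr hx)]

/-- The cocycle identity `λ(P₁ + P₂, P₃) = λ(P₁, P₂ + P₃) - λ(P₂, P₁) + λ(P₂, P₃)` for the slope
`λ(P, Q)` of the line through `P` and `Q`. Over `ℂ` one has
`λ(u, v) = ζ(u + v) - ζ(u) - ζ(v)` (up to normalization), with `ζ` the Weierstrass zeta function. -/
theorem slope_addX_addY_eq {x₁ x₂ x₃ y₁ y₂ y₃ : F} (h₁ : W.Equation x₁ y₁) (h₂ : W.Equation x₂ y₂)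
    (h₃ : W.Equation x₃ y₃) (h₂₁ : ¬(x₂ = x₁ ∧ y₂ = W.negY x₁ y₁))
    (h₂₃ : ¬(x₂ = x₃ ∧ y₂ = W.negY x₃ y₃))
    (hS : W.addX x₂ x₁ (W.slope x₂ x₁ y₂ y₁) ≠ x₃) (hT : x₁ ≠ W.addX x₂ x₃ (W.slope x₂ x₃ y₂ y₃)) :
    (W.addY x₂ x₁ y₂ (W.slope x₂ x₁ y₂ y₁) - y₃) / (W.addX x₂ x₁ (W.slope x₂ x₁ y₂ y₁) - x₃) =
    (y₁ - W.addY x₂ x₃ y₂ (W.slope x₂ x₃ y₂ y₃)) / (x₁ - W.addX x₂ x₃ (W.slope x₂ x₃ y₂ y₃)) -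
      W.slope x₂ x₁ y₂ y₁ + W.slope x₂ x₃ y₂ y₃ := by
  have ha := slope_mul h₂ h₁ h₂₁
  have hd := slope_mul h₂ h₃ h₂₃
  have hG := sub_mul_addX_sub h₂ h₁ h₂₁
  have hG' := sub_mul_addX_sub h₂ h₃ h₂₃
  set a := W.slope x₂ x₁ y₂ y₁
  set d := W.slope x₂ x₃ y₂ y₃
  rw [← sub_ne_zero] at hS hT
  have hxS : W.addX x₂ x₁ a = a ^ 2 + W.a₁ * a - W.a₂ - x₂ - x₁ := rfl
  have hxT : W.addX x₂ x₃ d = d ^ 2 + W.a₁ * d - W.a₂ - x₂ - x₃ := rfl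
  have hyS : W.addY x₂ x₁ y₂ a =
      -(a * (W.addX x₂ x₁ a - x₂) + y₂) - W.a₁ * W.addX x₂ x₁ a - W.a₃ := rfl
  have hyT : W.addY x₂ x₃ y₂ d =
      -(d * (W.addX x₂ x₃ d - x₂) + y₂) - W.a₁ * W.addX x₂ x₃ d - W.a₃ := rfl
  rw [hyS, hyT]
  generalize W.addX x₂ x₁ a = A at *
  generalize W.addX x₂ x₃ d = B at *
  clear_value a d
  obtain rfl : y₁ = y₂ - a * (x₂ - x₁) := by rw [ha]; ring
  obtain rfl : y₃ = y₂ - d * (x₂ - x₃) := by rw [hd]; ring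
  rw [div_eq_iff hS]
  refine mul_right_cancel₀ hT ?_
  have hw := div_mul_cancel₀ (y₂ - a * (x₂ - x₁) - (-(d * (B - x₂) + y₂) - W.a₁ * B - W.a₃)) hT
  subst hxS hxT
  -- With `A` and `B` eliminated by their definitions, the identity without denominators is
  -- `-(a + d + a₁)` times the difference of the relations `hG` and `hG'`, in which `a₄` cancels.
  linear_combination -(a + d + W.a₁) * (hG - hG') -
    (a ^ 2 + W.a₁ * a - W.a₂ - x₂ - x₁ - x₃) * hw

end

section

open Polynomial WeierstrassCurve.Affine IsDedekindDomain
open scoped Polynomial.Bivariate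

variable {k : Type*} [Field k] (W : WeierstrassCurve.Affine k)

/-! ### Slope functions and their translates -/

/-- The rational function `(Y - y) / (X - x)` attached to the affine point `P = (x, y)`: its value
at `u` is the slope of the line through `u` and `P`. It is zero for `P = 0`. -/
noncomputable def slopeFunction : W.Point → W.FunctionField
  | .zero => 0
  | .some x y _ => (genericY W - algebraMap k _ y) / (genericX W - algebraMap k _ x)

theorem slopeFunction_zero : slopeFunction W 0 = 0 := rfl

open scoped Classical in
theorem slopeFunction_some {x y : k} (h : W.Nonsingular x y) :
    slopeFunction W (.some x y h) = (W⁄W.FunctionField).slope (algebraMap k W.FunctionField x)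
      (genericX W) (algebraMap k W.FunctionField y) (genericY W) := by
  rw [slope_of_X_ne (genericX_ne W x).symm, slopeFunction, ← neg_sub, ← neg_sub (algebraMap _ _ x),
    neg_div_neg_eq]

section
variable [DecidableEq k]

open scoped Classical in
theorem constPoint_some {x y : k} (h : W.Nonsingular x y) :
    ∃ h', constPoint W (.some x y h) =
      .some (algebraMap k W.FunctionField x) (algebraMap k W.FunctionField y) h' :=
  ⟨_, rfl⟩

variable [W.IsElliptic]

open scoped Classical in
theorem coords_translatedPoint {x y : k} (h : W.Nonsingular x y) :
    coords (translatedPoint W (.some x y h)) =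
      ((W⁄W.FunctionField).addX (algebraMap k W.FunctionField x) (genericX W)
        (slopeFunction W (.some x y h)),
       (W⁄W.FunctionField).addY (algebraMap k W.FunctionField x) (genericX W)
        (algebraMap k W.FunctionField y) (slopeFunction W (.some x y h))) := by
  obtain ⟨h', he⟩ := constPoint_some W h
  rw [translatedPoint, he, add_comm, genericPoint, Point.add_of_X_ne (genericX_ne W x).symm,
    slopeFunction_some]
  rfl

/-- The `X`-coordinate of `η + P` is not the `X`-coordinate `c` of a `k`-point: otherwise `η + P`
would be that point or its negative. -/
theorem coords_translatedPoint_fst_ne (P : W.Point) (c : k) (hc : ∃ y, W.Equation c y) :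
    (coords (translatedPoint W P)).1 ≠ algebraMap k W.FunctionField c := by
  classical
  obtain ⟨y, hy⟩ := hc
  obtain ⟨h', he⟩ := constPoint_some W (equation_iff_nonsingular.mp hy)
  intro h
  rcases (Point.X_eq_iff (h₁ := nonsingular_coords (translatedPoint_ne_zero W P)) (h₂ := h')).mp h
    with h | h
  · rw [some_coords (translatedPoint_ne_zero W P), ← he] at h
    exact translatedPoint_ne W _ _ h
  · rw [some_coords (translatedPoint_ne_zero W P), ← he, ← map_neg] at h
    exact translatedPoint_ne W _ _ h

variable [IsAlgClosed k]

theorem translate_genericX (P : W.Point) :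
    translate W P (genericX W) = (coords (translatedPoint W P)).1 := by
  rw [translate, genericX, IsFractionRing.liftAlgHom_apply, IsFractionRing.lift_algebraMap]
  exact evalHom_X ..

theorem translate_genericY (P : W.Point) :
    translate W P (genericY W) = (coords (translatedPoint W P)).2 := by
  rw [translate, genericY, IsFractionRing.liftAlgHom_apply, IsFractionRing.lift_algebraMap]
  exact evalHom_Y ..

/-- Up to constants, translation by `A` sends `λ_P` to `λ_{P + A} - λ_A`, where `λ_P` is the slope
function of `P`. -/
theorem translate_slopeFunction (A P : W.Point) : ∃ c : k,
    translate W A (slopeFunction W P) =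
      slopeFunction W (P + A) - slopeFunction W A + algebraMap k _ c := by
  classical
  by_cases hA : A = 0
  · subst hA
    exact ⟨0, by rw [translate_zero]; simp [slopeFunction_zero]⟩
  by_cases hP : P = 0
  · subst hP
    exact ⟨0, by simp [slopeFunction_zero]⟩
  cases A with
  | zero => exact absurd rfl hA
  | some x y h =>
  cases P with
  | zero => exact absurd rfl hP
  | some x' y' h' =>
  have hX := coords_translatedPoint_fst_ne W (.some x y h) x' ⟨y', h'.1⟩
  have key : translate W (.some x y h) (slopeFunction W (.some x' y' h')) =
      ((coords (translatedPoint W (.some x y h))).2 - algebraMap k _ y') /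
      ((coords (translatedPoint W (.some x y h))).1 - algebraMap k _ x') := by
    rw [slopeFunction, map_div₀, map_sub, map_sub, translate_genericX, translate_genericY,
      AlgHom.commutes, AlgHom.commutes]
  rw [key]
  rw [coords_translatedPoint] at hX ⊢
  by_cases hneg : x = x' ∧ y = W.negY x' y'
  -- If `P = -A`, the points `η + A`, `-A` and `-η` are collinear. Their line is the image under
  -- negation of the line through `η` and `A`, and negation turns a slope `ℓ` into `-ℓ - a₁`.
  · obtain ⟨rfl, hy⟩ := hneg
    refine ⟨-W.a₁, ?_⟩
    rw [add_comm (Point.some x y' h'), Point.add_of_Y_eq rfl hy, slopeFunction_zero,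
      div_eq_iff (sub_ne_zero.mpr hX)]
    have hy' : y' = W.negY x y := by rw [hy, negY_negY]
    rw [hy']
    simp only [addY, negY, negAddY, map_sub, map_neg, map_mul]
    have h₁ : (W⁄W.FunctionField).a₁ = algebraMap k _ W.a₁ := rfl
    have h₃ : (W⁄W.FunctionField).a₃ = algebraMap k _ W.a₃ := rfl
    rw [h₁, h₃]
    ring
  · refine ⟨W.slope x x' y y', ?_⟩
    have hinj := (algebraMap k W.FunctionField).injective
    rw [add_comm (Point.some x' y' h'), Point.add_some hneg]
    have e := map_slope (W := W) (algebraMap k W.FunctionField) x x' y y'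
    rw [slopeFunction_some W h] at hX ⊢
    have hη := equation_generic W
    have hA := (W.map_equation hinj x y).mpr h.1
    have hP := (W.map_equation hinj x' y').mpr h'.1
    have := slope_addX_addY_eq hη hA hP (fun h => genericX_ne W x h.1.symm) (fun hh => hneg ?_) hX ?_
    · rw [this, slopeFunction, ← map_addX, ← map_addY, ← e]
      rfl
    · exact ⟨hinj hh.1,
        hinj <| hh.2.trans <| map_negY (W' := W) (algebraMap k W.FunctionField) x' y'⟩
    · erw [e, map_addX]
      exact genericX_ne W _

end

/-! ### Poles of slope functions -/

theorem inftyValuation_algebraMap {a : W.CoordinateRing} (ha : a ≠ 0) :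
    inftyValuation W (algebraMap _ _ a) =
      WithZero.exp ((Algebra.norm k[X] a).natDegree : ℤ) := by
  rw [inftyValuation, Valuation.extendToLocalization_apply_map_apply]
  exact if_neg ha

theorem inftyValuation_genericX_sub (x : k) :
    inftyValuation W (genericX W - algebraMap k _ x) = WithZero.exp 2 := by
  have h : genericX W - algebraMap k _ x =
      algebraMap W.CoordinateRing _ (CoordinateRing.XClass W x) := by
    rw [CoordinateRing.XClass, map_sub, map_sub, map_sub]; rfl
  have hX : CoordinateRing.XClass W x = (X - C x) • 1 + (0 : k[X]) • CoordinateRing.mk W Y := by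
    rw [zero_smul, add_zero, CoordinateRing.smul, mul_one, CoordinateRing.XClass]
  rw [h, inftyValuation_algebraMap W (CoordinateRing.XClass_ne_zero x), hX,
    natDegree_eq_of_degree_eq_some (n := 2)]
  · rfl
  · rw [CoordinateRing.degree_norm_smul_basis, degree_X_sub_C, degree_zero]
    rfl

theorem inftyValuation_genericY_sub (y : k) :
    inftyValuation W (genericY W - algebraMap k _ y) = WithZero.exp 3 := by
  have h : genericY W - algebraMap k _ y =
      algebraMap W.CoordinateRing _ (CoordinateRing.YClass W (C y)) := by
    rw [CoordinateRing.YClass, map_sub, map_sub]; rfl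
  have hY : CoordinateRing.YClass W (C y) = (-C y) • 1 + (1 : k[X]) • CoordinateRing.mk W Y := by
    rw [one_smul, CoordinateRing.smul, mul_one, CoordinateRing.YClass, map_sub, C_neg, map_neg]
    ring
  rw [h, inftyValuation_algebraMap W (CoordinateRing.YClass_ne_zero _), hY,
    natDegree_eq_of_degree_eq_some (n := 3)]
  · rfl
  · rw [CoordinateRing.degree_norm_smul_basis, degree_one, degree_neg]
    refine (max_eq_right ?_).trans rfl
    refine (nsmul_le_nsmul_right degree_C_le 2).trans ?_
    decide

theorem inftyValuation_slopeFunction {P : W.Point} (hP : P ≠ 0) :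
    inftyValuation W (slopeFunction W P) = WithZero.exp 1 := by
  cases P with
  | zero => exact absurd rfl hP
  | some x y h =>
    rw [slopeFunction, map_div₀, inftyValuation_genericX_sub, inftyValuation_genericY_sub,
      ← WithZero.exp_sub]
    rfl

variable [W.IsElliptic]

/-- The residue field at an affine point is `k`. -/
theorem exists_sub_algebraMap_mem_pointIdeal {x y : k} (h : W.Nonsingular x y)
    (r : W.CoordinateRing) : ∃ c : k, r - algebraMap k _ c ∈ (pointIdeal W h).asIdeal := by
  let e := CoordinateRing.quotientXYIdealEquiv (W' := W) (x := x) (y := C y) h.1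
  refine ⟨e (Ideal.Quotient.mk _ r), Ideal.Quotient.eq.mp (e.injective ?_)⟩
  exact (e.commutes _).symm

theorem eq_zero_of_algebraMap_mem_pointIdeal {x y : k} (h : W.Nonsingular x y) {c : k}
    (hc : algebraMap k _ c ∈ (pointIdeal W h).asIdeal) : c = 0 := by
  by_contra hc0
  exact (pointIdeal W h).isPrime.ne_top
    (Ideal.eq_top_of_isUnit_mem _ hc ((IsUnit.mk0 c hc0).map (algebraMap k _)))

variable [IsAlgClosed k]

/-- If `e` has a simple pole at an affine point and `f` at most a simple one, then some `f - c e` is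
regular there, because the residue field is `k`. -/
theorem exists_valuation_sub_smul_le_one {x y : k} (h : W.Nonsingular x y) {f e : W.FunctionField}
    (hf : (pointIdeal W h).valuation W.FunctionField f ≤ WithZero.exp 1)
    (he : (pointIdeal W h).valuation W.FunctionField e = WithZero.exp 1) :
    ∃ c : k, (pointIdeal W h).valuation W.FunctionField (f - c • e) ≤ 1 := by
  have he0 : e ≠ 0 := by
    rintro rfl
    rw [map_zero] at he
    exact WithZero.exp_ne_zero he.symm
  have hu : (pointIdeal W h).valuation W.FunctionField (f / e) ≤ 1 := by
    rw [map_div₀, he]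
    exact div_le_one_of_le₀ hf zero_le
  obtain ⟨r, hr⟩ := (pointIdeal W h).exists_valuation_sub_lt_of_integer hu 1
  obtain ⟨c, hc⟩ := exists_sub_algebraMap_mem_pointIdeal W h r
  rw [← HeightOneSpectrum.valuation_lt_one_iff_mem (K := W.FunctionField)] at hc
  refine ⟨c, ?_⟩
  have key : f - c • e =
      (algebraMap _ _ (r - algebraMap k _ c) - (algebraMap _ _ r - f / e)) * e := by
    rw [map_sub, ← IsScalarTower.algebraMap_apply, sub_sub_sub_cancel_left, sub_mul,
      div_mul_cancel₀ _ he0, Algebra.smul_def]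
  rw [← WithZero.lt_mul_exp_iff_le one_ne_zero, key, map_mul, he]
  exact mul_lt_mul_of_pos_right (Valuation.map_sub_lt _ hc hr) WithZero.exp_pos



theorem exists_eq_pointIdeal (v : HeightOneSpectrum W.CoordinateRing) :
    ∃ (x y : k) (h : W.Nonsingular x y), v = pointIdeal W h := by
  obtain ⟨x, y, h, hM⟩ := exists_eq_XYIdeal W v.asIdeal v.isMaximal
  exact ⟨x, y, equation_iff_nonsingular.mp h, HeightOneSpectrum.ext hM⟩

theorem mem_range_algebraMap {f : W.FunctionField}
    (hf : ∀ P : W.Point, P ≠ 0 → pointValuation W P f ≤ 1) :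
    ∃ r, algebraMap W.CoordinateRing W.FunctionField r = f := by
  refine HeightOneSpectrum.mem_integers_of_valuation_le_one W.FunctionField f fun v => ?_
  obtain ⟨x, y, h, rfl⟩ := exists_eq_pointIdeal W v
  exact hf (.some x y h) (Point.some_ne_zero h)

/-- A function with no poles except at most a simple one at infinity is constant. -/
theorem exists_eq_algebraMap {f : W.FunctionField}
    (hf : ∀ P : W.Point, P ≠ 0 → pointValuation W P f ≤ 1)
    (h0 : pointValuation W 0 f ≤ WithZero.exp 1) : ∃ c : k, algebraMap k _ c = f := by
  obtain ⟨r, rfl⟩ := mem_range_algebraMap W hf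
  by_cases hr : r = 0
  · exact ⟨0, by rw [hr, map_zero, map_zero]⟩
  change inftyValuation W _ ≤ _ at h0
  rw [inftyValuation_algebraMap W hr, WithZero.exp_le_exp, Nat.cast_le_one] at h0
  have h1 : (Algebra.norm k[X] r).natDegree = 0 := by
    have := CoordinateRing.natDegree_norm_ne_one (W' := W) r
    omega
  have h2 := degree_le_of_natDegree_le h1.le
  obtain ⟨p, q, rfl⟩ := CoordinateRing.exists_smul_basis_eq r
  rw [CoordinateRing.degree_norm_smul_basis, max_le_iff] at h2
  have hq : q = 0 := by
    by_contra hq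
    rw [degree_eq_natDegree hq] at h2
    exact absurd (WithBot.coe_le_coe.mp h2.2) (by simp)
  have hp : p.degree ≤ 0 := by
    by_contra! hp
    exact hp.not_ge ((le_add_of_nonneg_right hp.le).trans (two_nsmul p.degree ▸ h2.1))
  rw [hq, eq_C_of_degree_le_zero hp, zero_smul, add_zero, CoordinateRing.smul, mul_one]
  exact ⟨_, rfl⟩

/-- A function whose only pole is a simple one at infinity does not exist, since no norm from `k[W]`
has degree `1`; hence the slope function of `P` has an affine pole. -/
theorem exists_one_lt_pointValuation_slopeFunction {P : W.Point} (hP : P ≠ 0) :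
    ∃ Q : W.Point, Q ≠ 0 ∧ 1 < pointValuation W Q (slopeFunction W P) := by
  by_contra! h
  obtain ⟨r, hr⟩ := mem_range_algebraMap W h
  have hi := inftyValuation_slopeFunction W hP
  have h0 : r ≠ 0 := by
    rintro rfl
    rw [← hr, map_zero, map_zero] at hi
    exact WithZero.exp_ne_zero hi.symm
  rw [← hr, inftyValuation_algebraMap W h0, WithZero.exp_inj, Nat.cast_eq_one] at hi
  exact CoordinateRing.natDegree_norm_ne_one r hi

/-- If `m` vanishes at `-P`, then `m` times the slope function of `P` is regular on the affine curve:
the ideals of `P` and `-P` have product `(X - x)`, and `Y - y` vanishes at `P`. -/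
theorem valuation_mul_slopeFunction_le_one {x y : k} (h : W.Nonsingular x y)
    (v : HeightOneSpectrum W.CoordinateRing) {m : W.CoordinateRing}
    (hm : m ∈ CoordinateRing.XYIdeal W x (C (W.negY x y))) :
    v.valuation W.FunctionField (algebraMap _ _ m * slopeFunction W (.some x y h)) ≤ 1 := by
  have hmem : m * CoordinateRing.YClass W (C y) ∈ CoordinateRing.XIdeal W x := by
    rw [← CoordinateRing.XYIdeal_neg_mul h]
    exact Ideal.mul_mem_mul hm (Ideal.subset_span (by simp))
  obtain ⟨c, hc⟩ := Ideal.mem_span_singleton'.mp hmem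
  have : algebraMap _ _ m * slopeFunction W (.some x y h) = algebraMap _ _ c := by
    rw [slopeFunction, ← mul_div_assoc, div_eq_iff (sub_ne_zero.mpr (genericX_ne W x))]
    have := congrArg (algebraMap W.CoordinateRing W.FunctionField) hc
    rw [map_mul, map_mul, CoordinateRing.XClass, CoordinateRing.YClass] at this
    simp only [map_sub] at this
    exact this.symm
  rw [this]
  exact v.valuation_le_one c

theorem pointValuation_slopeFunction_le_one {P Q : W.Point} (hQ : Q ≠ 0) (h : Q ≠ -P) :
    pointValuation W Q (slopeFunction W P) ≤ 1 := by
  cases Q with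
  | zero => exact absurd rfl hQ
  | some s t hst =>
  cases P with
  | zero => rw [← Point.zero_def, slopeFunction_zero, map_zero]; exact zero_le_one
  | some x y hxy =>
  have hxy' := (nonsingular_neg (W' := W) x y).mpr hxy
  have hne : ¬ CoordinateRing.XYIdeal W x (C (W.negY x y)) ≤ (pointIdeal W hst).asIdeal := by
    intro hle
    have hX : CoordinateRing.XClass W x ∈ (pointIdeal W hst).asIdeal :=
      hle (Ideal.subset_span (by simp))
    have hY : CoordinateRing.YClass W (C (W.negY x y)) ∈ (pointIdeal W hst).asIdeal :=
      hle (Ideal.subset_span (by simp))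
    have hX' : CoordinateRing.XClass W s ∈ (pointIdeal W hst).asIdeal :=
      Ideal.subset_span (by simp)
    have hY' : CoordinateRing.YClass W (C t) ∈ (pointIdeal W hst).asIdeal :=
      Ideal.subset_span (by simp)
    have e₁ : CoordinateRing.XClass W x - CoordinateRing.XClass W s =
        algebraMap k _ (s - x) := by
      simp only [CoordinateRing.XClass, map_sub]
      rw [sub_sub_sub_cancel_left]
      rfl
    have e₂ : CoordinateRing.YClass W (C (W.negY x y)) - CoordinateRing.YClass W (C t) =
        algebraMap k _ (t - W.negY x y) := by
      simp only [CoordinateRing.YClass, map_sub]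
      rw [sub_sub_sub_cancel_left]
      rfl
    obtain rfl : s = x := sub_eq_zero.mp
      (eq_zero_of_algebraMap_mem_pointIdeal W hst (e₁ ▸ sub_mem hX hX'))
    obtain rfl : t = _ := sub_eq_zero.mp
      (eq_zero_of_algebraMap_mem_pointIdeal W hst (e₂ ▸ sub_mem hY hY'))
    exact h rfl
  obtain ⟨m, hm, hm'⟩ := SetLike.not_le_iff_exists.mp hne
  have := valuation_mul_slopeFunction_le_one W hxy (pointIdeal W hst) hm
  rwa [map_mul, (HeightOneSpectrum.valuation_eq_one_iff_notMem (pointIdeal W hst)).mpr hm', one_mul] at this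

variable [DecidableEq k]

theorem pointValuation_neg_slopeFunction {P : W.Point} (hP : P ≠ 0) :
    pointValuation W (-P) (slopeFunction W P) = WithZero.exp 1 := by
  have hlt : 1 < pointValuation W (-P) (slopeFunction W P) := by
    obtain ⟨Q, hQ, hlt⟩ := exists_one_lt_pointValuation_slopeFunction W hP
    by_cases h : Q = -P
    · rwa [← h]
    · exact absurd hlt (pointValuation_slopeFunction_le_one W hQ h).not_gt
  refine le_antisymm ?_ ?_
  · cases P with
    | zero => exact absurd rfl hP
    | some x y h =>
    have h' := (nonsingular_neg (W' := W) x y).mpr h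
    change (pointIdeal W h').valuation _ _ ≤ _
    obtain ⟨m, hm⟩ := (pointIdeal W h').intValuation_exists_uniformizer
    have := valuation_mul_slopeFunction_le_one W h (pointIdeal W h') (m := m)
      (((pointIdeal W h').intValuation_lt_one_iff_mem m).mp (by rw [hm]; decide))
    rw [map_mul, HeightOneSpectrum.valuation_of_algebraMap, hm] at this
    rwa [WithZero.exp_neg, inv_mul_le_iff₀ WithZero.exp_pos, mul_one] at this
  · by_contra! hle
    rw [← one_mul (WithZero.exp 1), WithZero.lt_mul_exp_iff_le one_ne_zero] at hle
    exact hle.not_gt hlt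

end

/-! ### A criterion for the regular representation -/

section

open Module

/-- A representation with a basis `b`, indexed by the group, whose member `b 0` is invariant and
whose other members satisfy `a • e g = e (g + a) - e a` modulo `b 0`, is the regular one.
The equivalence is `f ↦ (x ↦ r (x • f) + l f)`, where `r`, minus the sum of the coordinates off
`0`, plays the role of the residue at the origin, and the invariant functional `l` recovers the
multiples of `b 0`, which have no residues. -/
theorem nonempty_equiv_regularRep {k G V : Type*} [Field k] [AddCommGroup G] [Finite G]
    [AddCommGroup V] [Module k V] (ρ : Representation k (Multiplicative G) V)
    (hn : (Nat.card G : k) ≠ 0) (b : Basis G k V)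
    (h0 : ∀ a, ρ a (b 0) = b 0) (e : G → V) (he0 : e 0 = 0)
    (heb : ∀ g, g ≠ 0 → b g = e g)
    (he : ∀ a g, ∃ c : k, ρ (.ofAdd a) (e g) = e (g + a) - e a + c • b 0) :
    Nonempty (ρ.Equiv (regularRep k (Multiplicative G))) := by
  classical
  have := Fintype.ofFinite G
  let r : V →ₗ[k] k := b.constr k fun g => if g = 0 then 0 else -1
  have hr : ∀ x, r (e x) = if x = 0 then 0 else -1 := by
    intro x
    split_ifs with hx
    · rw [hx, he0, map_zero]
    · rw [← heb x hx, b.constr_basis, if_neg hx]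
  have hr0 : r (b 0) = 0 := by rw [b.constr_basis, if_pos rfl]
  have hre : ∀ a g, r (ρ (.ofAdd a) (e g)) = r (e (g + a)) - r (e a) := by
    intro a g
    obtain ⟨c, hc⟩ := he a g
    rw [hc, map_add, map_smul, hr0, smul_zero, add_zero, map_sub]
  -- The residue of `f` at a nonzero point is a coordinate of `f`.
  have hcoord : ∀ a, a ≠ 0 → r ∘ₗ ρ (.ofAdd a) = b.coord (-a) := by
    intro a ha
    refine b.ext fun g => ?_
    rw [LinearMap.comp_apply, b.coord_apply, b.repr_self, Finsupp.single_apply]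
    by_cases hg : g = 0
    · rw [hg, h0, hr0, if_neg (by simpa [eq_comm] using ha)]
    · rw [heb g hg, hre, hr, hr, if_neg ha]
      simp only [eq_neg_iff_add_eq_zero]
      split_ifs <;> simp
  -- The residue theorem for this model: the sum of the residues over all translates vanishes.
  have hsum : ∑ a : G, r ∘ₗ ρ (.ofAdd a) = 0 := by
    refine b.ext fun g => ?_
    rw [LinearMap.sum_apply, LinearMap.zero_apply]
    simp only [LinearMap.comp_apply]
    by_cases hg : g = 0
    · simp [hg, h0, hr0]
    · simp_rw [heb g hg, hre, Finset.sum_sub_distrib]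
      rw [sub_eq_zero]
      exact Equiv.sum_comp (Equiv.addLeft g) fun x => r (e x)
  -- The unnormalized average of the coordinate at `0` over the group; it sends `b 0` to `|G|`.
  let l : V →ₗ[k] k := ∑ a : Multiplicative G, b.coord 0 ∘ₗ ρ a
  have hl : ∀ g f, l (ρ g f) = l f := by
    intro g f
    simp only [l, LinearMap.sum_apply, LinearMap.comp_apply, ← Module.End.mul_apply, ← map_mul]
    exact Equiv.sum_comp (Equiv.mulRight g) fun x => b.coord 0 (ρ x f)
  let Φ : V →ₗ[k] (Multiplicative G → k) := LinearMap.pi fun x => r ∘ₗ ρ x + l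
  have hΦ : Function.Injective Φ := by
    refine (injective_iff_map_eq_zero Φ).mpr fun f hf => ?_
    have hx : ∀ x : G, r (ρ (.ofAdd x) f) + l f = 0 := fun x => congrFun hf (.ofAdd x)
    have hlf : l f = 0 := by
      have h1 := Finset.sum_congr rfl fun x (_ : x ∈ Finset.univ) => hx x
      have h2 := LinearMap.congr_fun hsum f
      rw [LinearMap.sum_apply] at h2
      simp only [LinearMap.comp_apply, LinearMap.zero_apply] at h2
      rw [Finset.sum_add_distrib, h2, zero_add, Finset.sum_const_zero, Finset.sum_const,
        nsmul_eq_mul, Finset.card_univ, ← Nat.card_eq_fintype_card] at h1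
      exact (mul_eq_zero.mp h1).resolve_left hn
    have hc : ∀ g, g ≠ 0 → b.coord g f = 0 := by
      intro g hg
      have h1 := hx (-g)
      have h2 := LinearMap.congr_fun (hcoord (-g) (neg_ne_zero.mpr hg)) f
      rw [neg_neg] at h2
      rw [← h2, LinearMap.comp_apply]
      rwa [hlf, add_zero] at h1
    have hf0 : f = b.coord 0 f • b 0 := by
      conv_lhs => rw [← b.sum_repr f]
      exact Fintype.sum_eq_single 0 fun g hg => by rw [← b.coord_apply, hc g hg, zero_smul]
    have hl0 : l (b 0) = Nat.card G := by
      simp [l, h0]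
    rw [hf0, map_smul, hl0, smul_eq_mul] at hlf
    rw [hf0, (mul_eq_zero.mp hlf).resolve_right hn, zero_smul]
  have := b.finiteDimensional_of_finite
  have hd : finrank k V = finrank k (Multiplicative G → k) := by
    rw [finrank_fintype_fun_eq_card, finrank_eq_card_basis b]
    exact Fintype.card_congr Multiplicative.ofAdd
  refine ⟨.mk (LinearMap.linearEquivOfInjective Φ hΦ hd) fun g => LinearMap.ext fun f =>
    funext fun x => ?_⟩
  change r (ρ x (ρ g f)) + l (ρ g f) = r (ρ (x * g) f) + l f
  rw [hl, map_mul, Module.End.mul_apply]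

end

/-! ### A basis of `L(G)` -/

section

open WeierstrassCurve.Affine

variable {k : Type*} [Field k] (W : WeierstrassCurve.Affine k)

section

variable [DecidableEq k] (G : AddSubgroup W.Point)

open scoped Classical in
/-- The family indexed by `G` that turns out to be a basis of `L(G)`: the constant function `1` at
`0`, and the slope function of `g` at every other `g`. -/
noncomputable def slopeFamily (g : G) : W.FunctionField :=
  if g = 0 then 1 else slopeFunction W g

theorem slopeFamily_zero : slopeFamily W G 0 = 1 := if_pos rfl

theorem slopeFamily_of_ne {g : G} (hg : g ≠ 0) : slopeFamily W G g = slopeFunction W g := if_neg hg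

theorem one_mem_span_slopeFamily : 1 ∈ Submodule.span k (Set.range (slopeFamily W G)) :=
  Submodule.subset_span ⟨0, slopeFamily_zero W G⟩

theorem slopeFunction_mem_span (g : G) :
    slopeFunction W g ∈ Submodule.span k (Set.range (slopeFamily W G)) := by
  by_cases hg : g = 0
  · rw [hg, ZeroMemClass.coe_zero, slopeFunction_zero]
    exact zero_mem _
  · exact Submodule.subset_span ⟨g, slopeFamily_of_ne W G hg⟩

open scoped Classical in
theorem subgroupDivisor_apply [Finite G] (P : W.Point) :
    subgroupDivisor W G P = if P ∈ G then 1 else 0 := by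
  have := Fintype.ofFinite G
  rw [subgroupDivisor, finsum_eq_sum_of_fintype, Finsupp.finsetSum_apply]
  split_ifs with hP
  · rw [Fintype.sum_eq_single ⟨P, hP⟩, Finsupp.single_eq_same]
    intro g hg
    exact Finsupp.single_eq_of_ne fun h => hg (Subtype.ext h.symm)
  · refine Finset.sum_eq_zero fun g _ => Finsupp.single_eq_of_ne ?_
    rintro rfl
    exact hP g.2

end

variable [W.IsElliptic] [IsAlgClosed k] [DecidableEq k]

/-- A function with at most simple poles, all in `s` or at infinity, is a linear combination of `1`
and the slope functions with a pole in `s`: subtracting multiples of the latter removes the affine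
poles one at a time, and what remains is constant. -/
theorem mem_of_pointValuation_le (T : Submodule k W.FunctionField) (h1 : 1 ∈ T)
    (s : Finset W.Point) (hs : ∀ P ∈ s, slopeFunction W (-P) ∈ T) {f : W.FunctionField}
    (hf0 : pointValuation W 0 f ≤ WithZero.exp 1)
    (hfs : ∀ P ∈ s, pointValuation W P f ≤ WithZero.exp 1)
    (hf : ∀ P, P ≠ 0 → P ∉ s → pointValuation W P f ≤ 1) : f ∈ T := by
  classical
  induction s using Finset.induction_on generalizing f with
  | empty =>
    obtain ⟨c, rfl⟩ := exists_eq_algebraMap W (fun P hP => hf P hP (Finset.notMem_empty P)) hf0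
    rw [Algebra.algebraMap_eq_smul_one]
    exact T.smul_mem c h1
  | insert a s ha ih =>
    have hs' : ∀ P ∈ s, slopeFunction W (-P) ∈ T := fun P hP => hs P (Finset.mem_insert_of_mem hP)
    by_cases ha0 : a = 0
    · refine ih hs' hf0 (fun P hP => hfs P (Finset.mem_insert_of_mem hP)) fun P hP0 hP => ?_
      exact hf P hP0 (by simp [ha0, hP0, hP])
    have hna : -a ≠ 0 := neg_ne_zero.mpr ha0
    have hpole := pointValuation_neg_slopeFunction W hna
    have hreg : ∀ P, P ≠ 0 → P ≠ a → pointValuation W P (slopeFunction W (-a)) ≤ 1 :=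
      fun P hP0 hP => pointValuation_slopeFunction_le_one W hP0 (by rwa [neg_neg])
    rw [neg_neg] at hpole
    obtain ⟨c, hc⟩ : ∃ c : k, pointValuation W a (f - c • slopeFunction W (-a)) ≤ 1 := by
      have hfa := hfs a (Finset.mem_insert_self a s)
      cases a with
      | zero => exact absurd rfl ha0
      | some x y h => exact exists_valuation_sub_smul_le_one W h hfa hpole
    have hsub : ∀ {P γ}, pointValuation W P f ≤ γ →
        pointValuation W P (slopeFunction W (-a)) ≤ γ →
        pointValuation W P (f - c • slopeFunction W (-a)) ≤ γ := by
      intro P γ h₁ h₂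
      refine (Valuation.map_sub _ _ _).trans (max_le h₁ ?_)
      rw [Algebra.smul_def, map_mul]
      exact (mul_le_of_le_one_left' (pointValuation_algebraMap_le W P c)).trans h₂
    rw [← sub_add_cancel f (c • slopeFunction W (-a))]
    refine T.add_mem ?_ (T.smul_mem c (hs a (Finset.mem_insert_self a s)))
    have h1exp : (1 : WithZero (Multiplicative ℤ)) ≤ WithZero.exp 1 := by decide
    refine ih hs' (hsub hf0 (inftyValuation_slopeFunction W hna).le) (fun P hP => ?_)
      fun P hP0 hP => ?_
    · by_cases hP0 : P = 0
      · subst hP0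
        exact hsub hf0 (inftyValuation_slopeFunction W hna).le
      · refine hsub (hfs P (Finset.mem_insert_of_mem hP)) ((hreg P hP0 ?_).trans h1exp)
        rintro rfl
        exact ha hP
    · by_cases hPa : P = a
      · rwa [hPa]
      · exact hsub (hf P hP0 (by simp [hPa, hP])) (hreg P hP0 hPa)

variable (G : AddSubgroup W.Point)

theorem translate_mem_span (a : G) {f : W.FunctionField}
    (hf : f ∈ Submodule.span k (Set.range (slopeFamily W G))) :
    translate W a f ∈ Submodule.span k (Set.range (slopeFamily W G)) := by
  induction hf using Submodule.span_induction with
  | zero => rw [map_zero]; exact zero_mem _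
  | add f g _ _ hf hg => rw [map_add]; exact add_mem hf hg
  | smul c f _ hf => rw [map_smul]; exact Submodule.smul_mem _ c hf
  | mem f hf =>
    obtain ⟨g, rfl⟩ := hf
    by_cases hg : g = 0
    · rw [hg, slopeFamily_zero, map_one]
      exact one_mem_span_slopeFamily W G
    · obtain ⟨c, hc⟩ := translate_slopeFunction W a g
      rw [slopeFamily_of_ne W G hg, hc, Algebra.algebraMap_eq_smul_one]
      exact add_mem (sub_mem (slopeFunction_mem_span W G (g + a)) (slopeFunction_mem_span W G a))
        (Submodule.smul_mem _ c (one_mem_span_slopeFamily W G))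

variable [Finite G]

/-- Only the member indexed by `g` has a pole at `-g`. -/
theorem slopeFamily_linearIndependent : LinearIndependent k (slopeFamily W G) := by
  classical
  have := Fintype.ofFinite G
  refine Fintype.linearIndependent_iff.mpr fun c hc => ?_
  have hne : ∀ g, g ≠ 0 → c g = 0 := by
    intro g hg
    have hg' : (g : W.Point) ≠ 0 := fun h => hg (Subtype.ext h)
    by_contra hcg
    have hle : ∀ i ∈ Finset.univ.erase g,
        pointValuation W (-g) (c i • slopeFamily W G i) ≤ 1 := by
      intro i hi
      rw [Algebra.smul_def, map_mul]
      refine mul_le_one' (pointValuation_algebraMap_le W _ _) ?_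
      by_cases hi0 : i = 0
      · rw [hi0, slopeFamily_zero, map_one]
      · rw [slopeFamily_of_ne W G hi0]
        refine pointValuation_slopeFunction_le_one W (neg_ne_zero.mpr hg') fun h => ?_
        exact Finset.ne_of_mem_erase hi (Subtype.ext (neg_injective h)).symm
    have hsum := Valuation.map_sum_le _ hle
    rw [← Finset.add_sum_erase _ _ (Finset.mem_univ g), add_eq_zero_iff_eq_neg'] at hc
    rw [hc, Valuation.map_neg] at hsum
    have hu : slopeFunction W g = algebraMap k _ (c g)⁻¹ * (c g • slopeFamily W G g) := by
      rw [← Algebra.smul_def, inv_smul_smul₀ hcg, slopeFamily_of_ne W G hg]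
    have hv := pointValuation_neg_slopeFunction W hg'
    rw [hu, map_mul] at hv
    have : WithZero.exp (1 : ℤ) ≤ 1 :=
      hv ▸ mul_le_one' (pointValuation_algebraMap_le W _ _) hsum
    exact absurd this (by decide)
  intro g
  by_cases hg : g = 0
  · rw [Fintype.sum_eq_single 0 fun x hx => by rw [hne x hx, zero_smul], slopeFamily_zero] at hc
    rw [hg]
    exact (smul_eq_zero.mp hc).resolve_right one_ne_zero
  · exact hne g hg

theorem subgroupSpace_eq_span :
    subgroupSpace W G = Submodule.span k (Set.range (slopeFamily W G)) := by
  classical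
  have := Fintype.ofFinite G
  have hone : (1 : WithZero (Multiplicative ℤ)) ≤ WithZero.exp 1 := by decide
  have hle : ∀ P : W.Point, 1 ≤ WithZero.exp (subgroupDivisor W G P) := by
    intro P
    rw [subgroupDivisor_apply]
    split_ifs
    · exact hone
    · exact le_rfl
  refine le_antisymm (fun f hf => ?_) (Submodule.span_le.mpr ?_)
  · have hf' : ∀ P, pointValuation W P f ≤ WithZero.exp (if P ∈ G then 1 else 0) := fun P =>
      subgroupDivisor_apply W G P ▸ hf P
    refine mem_of_pointValuation_le W _ (one_mem_span_slopeFamily W G)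
      (Finset.univ.image fun g : G => (g : W.Point)) ?_ ?_ ?_ ?_
    · intro P hP
      obtain ⟨g, -, rfl⟩ := Finset.mem_image.mp hP
      exact slopeFunction_mem_span W G (-g)
    · simpa using hf' 0
    · intro P hP
      obtain ⟨g, -, rfl⟩ := Finset.mem_image.mp hP
      simpa using hf' g
    · intro P _ hP
      have := hf' P
      rwa [if_neg fun h => hP (Finset.mem_image.mpr ⟨⟨P, h⟩, Finset.mem_univ _, rfl⟩)] at this
  · rintro _ ⟨g, rfl⟩ P
    by_cases hg : g = 0
    · rw [hg, slopeFamily_zero, map_one]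
      exact hle P
    have hg' : (g : W.Point) ≠ 0 := fun h => hg (Subtype.ext h)
    rw [slopeFamily_of_ne W G hg]
    by_cases hP0 : P = 0
    · rw [hP0, subgroupDivisor_apply, if_pos G.zero_mem]
      exact (inftyValuation_slopeFunction W hg').le
    by_cases hP : P = -g
    · rw [hP, subgroupDivisor_apply, if_pos (G.neg_mem g.2)]
      exact (pointValuation_neg_slopeFunction W hg').le
    · exact (pointValuation_slopeFunction_le_one W hP0 hP).trans (hle P)

/-- The basis of `L(G)` formed by `1` and the slope functions of the nonzero elements of `G`. -/
noncomputable def slopeBasis : Module.Basis G k (subgroupSpace W G) :=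
  (Module.Basis.span (slopeFamily_linearIndependent W G)).map
    (LinearEquiv.ofEq _ _ (subgroupSpace_eq_span W G).symm)

theorem coe_slopeBasis (g : G) : (slopeBasis W G g : W.FunctionField) = slopeFamily W G g := by
  rw [slopeBasis, Module.Basis.map_apply, LinearEquiv.coe_ofEq_apply, Module.Basis.span_apply]

/-! ### The action of `G` -/

theorem subgroupSpace_le_comap (g : Multiplicative G) :
    subgroupSpace W G ≤ (subgroupSpace W G).comap (subgroupRep W G g) := by
  rw [subgroupSpace_eq_span]
  exact fun f hf => translate_mem_span W G g.toAdd hf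

theorem nonempty_subgroupSpace_equiv (hn : (Nat.card G : k) ≠ 0) :
    Nonempty (((subgroupRep W G).subrepresentation (subgroupSpace W G)
      (subgroupSpace_le_comap W G)).Equiv (regularRep k (Multiplicative G))) := by
  have hmem : ∀ g : G, slopeFunction W g ∈ subgroupSpace W G := fun g => by
    rw [subgroupSpace_eq_span]
    exact slopeFunction_mem_span W G g
  refine nonempty_equiv_regularRep _ hn (slopeBasis W G) (fun a => ?_)
    (fun g => ⟨slopeFunction W g, hmem g⟩) rfl (fun g hg => ?_) fun a g => ?_
  · refine Subtype.ext ?_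
    change translate W _ (slopeBasis W G 0 : W.FunctionField) = slopeBasis W G 0
    rw [coe_slopeBasis, slopeFamily_zero, map_one]
  · exact Subtype.ext ((coe_slopeBasis W G g).trans (slopeFamily_of_ne W G hg))
  · obtain ⟨c, hc⟩ := translate_slopeFunction W a g
    refine ⟨c, Subtype.ext ?_⟩
    change translate W a (slopeFunction W g) = slopeFunction W (g + a) - slopeFunction W a +
      c • (slopeBasis W G 0 : W.FunctionField)
    rw [coe_slopeBasis, slopeFamily_zero, hc, Algebra.algebraMap_eq_smul_one]

/-- An equivalence of `L(G)` with the regular representation identifies the Jacobi functions for `χ`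
with the nonzero multiples of the function `χ` on `G`. -/
theorem exists_isJacobiFunction
    (φ : ((subgroupRep W G).subrepresentation (subgroupSpace W G)
      (subgroupSpace_le_comap W G)).Equiv (regularRep k (Multiplicative G)))
    (χ : Multiplicative G →* kˣ) :
    ∃ f : W.FunctionField, IsJacobiFunction W G χ f ∧
      ∀ f' : W.FunctionField, IsJacobiFunction W G χ f' ↔ ∃ c : kˣ, f' = (c : k) • f := by
  let ρ := (subgroupRep W G).subrepresentation (subgroupSpace W G) (subgroupSpace_le_comap W G)
  let e := φ.toLinearEquiv
  have he : ∀ g v h, e (ρ g v) h = e v (h * g) := fun g v h =>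
    congrFun (LinearMap.congr_fun (φ.isIntertwining' g) v) h
  let F : Multiplicative G → k := fun g => χ g
  let f := e.symm F
  have hF : e f = F := e.apply_symm_apply F
  have hf : IsJacobiFunction W G χ (f : W.FunctionField) := by
    refine ⟨f.2, fun h0 => ?_, fun g => ?_⟩
    · have h1 : F = 0 := by
        rw [← hF, show f = 0 from Subtype.ext h0, map_zero]
      exact (χ 1).ne_zero (congrFun h1 1)
    · have h1 : ρ (.ofAdd g) f = (χ (.ofAdd g) : k) • f := by
        refine e.injective (funext fun h => ?_)
        rw [he, map_smul, hF, Pi.smul_apply, smul_eq_mul]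
        simp only [F]
        rw [map_mul, Units.val_mul, mul_comm]
      exact congrArg Subtype.val h1
  refine ⟨f, hf, fun f' => ⟨fun ⟨hmem, hne, hχ⟩ => ?_, ?_⟩⟩
  · let v : subgroupSpace W G := ⟨f', hmem⟩
    have hv : e v = e v 1 • F := by
      funext h
      have h1 : ρ h v = (χ h : k) • v := Subtype.ext (hχ h.toAdd)
      have h2 := he h v 1
      rw [one_mul, h1, map_smul] at h2
      rw [← h2, Pi.smul_apply, Pi.smul_apply, smul_eq_mul, smul_eq_mul, mul_comm]
    have hvf : v = e v 1 • f := e.injective (by rw [map_smul, hF]; exact hv)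
    have h0 : e v 1 ≠ 0 := by
      intro h0
      rw [h0, zero_smul] at hvf
      exact hne (congrArg Subtype.val hvf)
    exact ⟨Units.mk0 _ h0, congrArg Subtype.val hvf⟩
  · rintro ⟨c, rfl⟩
    obtain ⟨h1, h2, h3⟩ := hf
    refine ⟨Submodule.smul_mem _ _ h1, smul_ne_zero c.ne_zero h2, fun g => ?_⟩
    rw [map_smul, h3, smul_comm]

end

end JacobiFunctions

theorem theorem2 {k : Type*} [Field k] [IsAlgClosed k] [DecidableEq k] (p : ℕ) [CharP k p]
    (W : WeierstrassCurve.Affine k) [W.IsElliptic] (G : AddSubgroup W.Point) [Finite G]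
    (hp : ¬ p ∣ Nat.card G) :
    Module.finrank k (JacobiFunctions.subgroupSpace W G) = Nat.card G ∧
    (∃ hL : ∀ g, JacobiFunctions.subgroupSpace W G ≤
        (JacobiFunctions.subgroupSpace W G).comap (JacobiFunctions.subgroupRep W G g),
      Nonempty (((JacobiFunctions.subgroupRep W G).subrepresentation
        (JacobiFunctions.subgroupSpace W G) hL).Equiv
          (JacobiFunctions.regularRep k (Multiplicative G)))) ∧
    ∀ χ : Multiplicative G →* kˣ, ∃ f : W.FunctionField,
      JacobiFunctions.IsJacobiFunction W G χ f ∧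
      ∀ f' : W.FunctionField, JacobiFunctions.IsJacobiFunction W G χ f' ↔
        ∃ c : kˣ, f' = (c : k) • f := by
  have hφ := JacobiFunctions.nonempty_subgroupSpace_equiv W G
    (mt (CharP.cast_eq_zero_iff k p _).mp hp)
  exact ⟨Module.finrank_eq_nat_card_basis (JacobiFunctions.slopeBasis W G),
    ⟨JacobiFunctions.subgroupSpace_le_comap W G, hφ⟩,
    JacobiFunctions.exists_isJacobiFunction W G hφ.some⟩
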